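/- Let $G$ be a discrete group. A $G$-boundary is a non-empty compact Hausdorff space $X$ on which $G$ acts by homeomorphisms such that the action is minimal (every orbit is dense) and strongly proximal (for every regular Borel probability measure $\nu$ on $X$, the weak* closure of the orbit $G\nu$ contains a point mass). A Furstenberg boundary $\partial_F G$ of $G$ is a universal $G$-boundary, i.e. a $G$-boundary that maps continuously and $G$-equivariantly onto every $G$-boundary. The group $G$ is amenable if there is a unital positive linear functional on $\ell^\infty(G)$ that is invariant under left translation. Every discrete group $G$ has a Furstenberg boundary, and every Furstenberg boundary $\partial_F G$ of $G$ satisfies the following. 1. $\partial_F G$ is either a single point or non-metrizable. 2. $\partial_F G$ is a single point if and only if $G$ is amenable. 3. If $G$ is amenable, then $C(\partial_F G) = \mathbb{C}$, i.e. every continuous function $\partial_F G \to \mathbb{C}$ is constant. 4. If $G$ is non-amenable, then $\partial_F G$ is non-metrizable, $\partial_F G$ has no isolated points, and $C(\partial_F G)$, with the supremum norm, is non-separable. -/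

import Mathlib

open MeasureTheory Topology
open scoped ENNReal ComplexOrder

universe u

namespace Furstenberg

/-- Left translation on `ℓ^∞(G)`: `(s f)(t) = f (s⁻¹ t)`. -/
noncomputable def leftTranslate {G : Type*} [Group G] (s : G) (f : lp (fun _ : G => ℂ) ∞) :
    lp (fun _ : G => ℂ) ∞ :=
  ⟨fun t => f (s⁻¹ * t), memℓp_infty (by
    obtain ⟨C, hC⟩ := (lp.memℓp f).bddAbove
    refine ⟨C, ?_⟩
    rintro _ ⟨t, rfl⟩
    exact hC ⟨s⁻¹ * t, rfl⟩)⟩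

/-- A discrete group is amenable if `ℓ^∞(G)` has a left-invariant mean, that is, a unital positive
linear functional that is invariant under left translation. -/
def IsAmenable (G : Type*) [Group G] : Prop :=
  ∃ m : lp (fun _ : G => ℂ) ∞ →ₗ[ℂ] ℂ,
    m 1 = 1 ∧
    (∀ f : lp (fun _ : G => ℂ) ∞, (∀ t, 0 ≤ f t) → 0 ≤ m f) ∧
    ∀ (s : G) (f : lp (fun _ : G => ℂ) ∞), m (leftTranslate s f) = m f

/-- Strong proximality: the weak* closure of the orbit `G ν` of each regular Borel probability
measure `ν` on `X` contains a point mass. The measurable structure is the Borel one, and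
`ProbabilityMeasure X` carries the topology of convergence against continuous functions. -/
def IsStronglyProximal (G X : Type*) [Group G] [TopologicalSpace X] [MulAction G X] : Prop :=
  ∀ [MeasurableSpace X] [BorelSpace X] (ν : ProbabilityMeasure X),
    (ν : Measure X).Regular →
      ∃ x : X, diracProba x ∈ closure
        {μ : ProbabilityMeasure X |
          ∃ s : G, (μ : Measure X) = (ν : Measure X).map (fun y => s • y)}

/-- A `G`-boundary of the discrete group `G`: a non-empty compact Hausdorff space on which `G` acts
by homeomorphisms, such that the action is minimal and strongly proximal. -/
structure IsBoundary (G X : Type*) [Group G] [TopologicalSpace X] [MulAction G X] : Prop where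
  nonempty : Nonempty X
  compactSpace : CompactSpace X
  t2Space : T2Space X
  continuousConstSMul : ContinuousConstSMul G X
  isMinimal : MulAction.IsMinimal G X
  isStronglyProximal : IsStronglyProximal G X

/-- `X` is (a model of) the Furstenberg boundary of `G`: a `G`-boundary that maps continuously and
`G`-equivariantly onto every `G`-boundary. Every `G`-boundary is a quotient of the Stone-Čech
compactification of `G`, so that up to isomorphism all of them live in the universe of `G`. -/
structure IsFurstenbergBoundary (G X : Type u) [Group G] [TopologicalSpace X] [MulAction G X] :
    Prop where
  isBoundary : IsBoundary G X
  universal : ∀ (B : Type u) [TopologicalSpace B] [MulAction G B], IsBoundary G B →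
    ∃ f : X → B, Continuous f ∧ (∀ (s : G) (x : X), f (s • x) = s • f x) ∧ Function.Surjective f

end Furstenberg

/-!
A state of a space is a positive unital functional on its bounded continuous functions. On a
`G`-boundary `B` every state can be moved arbitrarily close to every point mass, so a minimal flow
that maps equivariantly and continuously into the states of `B` already maps into the point masses,
and the only such map from `B` itself is `x ↦ δ_x`.

Following Glasner, take a minimal compact convex invariant set `Q` of means on `G`, and let `M` be
the closure of its extreme points. By minimality the orbit of any state of `M` has all of `Q` as
barycenters of its closed convex hull. An extreme point `q` is the barycenter of `δ_q` only, whence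
`M` is a boundary. Orbit maps push means on `G` to states of any boundary `B`, so `M` maps onto `B`.

A Furstenberg boundary `X` thus maps equivariantly to the means on `G`, and a one-point boundary is
an invariant mean. The orbit map of `b : X` embeds `C(X)` in `ℓ^∞(G)`, and the Poisson transform of
`X → means(G)` is a positive left inverse of this embedding, so `X` is extremally disconnected. If
`X` is moreover metrizable then it is discrete, and a boundary with an isolated point is a point.
-/

namespace Furstenberg

open scoped BoundedContinuousFunction

section States

variable {X Y Z : Type*} [TopologicalSpace X] [TopologicalSpace Y] [TopologicalSpace Z]

instance locallyConvexSpace_weakDual {E : Type*} [NormedAddCommGroup E] [NormedSpace ℝ E] :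
    LocallyConvexSpace ℝ (WeakDual ℝ E) :=
  (WeakDual.withSeminorms ℝ E).toLocallyConvexSpace

/-- The bounded functionals on the bounded continuous real functions on `X`, with the weak*
topology. -/
abbrev Functional (X : Type*) [TopologicalSpace X] := WeakDual ℝ (X →ᵇ ℝ)

/-- The state space of `X`: the positive unital functionals. For compact Hausdorff `X` these are the
regular Borel probability measures; for discrete `X` they are the means on `ℓ^∞(X)`. -/
def stateSpace (X : Type*) [TopologicalSpace X] : Set (Functional X) :=
  {φ | φ 1 = 1 ∧ ∀ f : X →ᵇ ℝ, 0 ≤ f → 0 ≤ φ f}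

theorem apply_le_apply_of_mem_stateSpace {φ : Functional X} (hφ : φ ∈ stateSpace X)
    {f g : X →ᵇ ℝ} (h : f ≤ g) : φ f ≤ φ g := by
  simpa using hφ.2 (g - f) (sub_nonneg.2 h)

theorem apply_const_of_mem_stateSpace {φ : Functional X} (hφ : φ ∈ stateSpace X) (c : ℝ) :
    φ (.const X c) = c := by
  have hc : BoundedContinuousFunction.const X c = c • 1 := by ext; simp
  rw [hc, map_smul, hφ.1, smul_eq_mul, mul_one]

theorem abs_apply_le_of_mem_stateSpace {φ : Functional X} (hφ : φ ∈ stateSpace X)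
    {f g : X →ᵇ ℝ} (h : |f| ≤ g) : |φ f| ≤ φ g := by
  have hneg := apply_le_apply_of_mem_stateSpace hφ ((neg_le_abs f).trans h)
  rw [map_neg] at hneg
  exact abs_le.2 ⟨neg_le.1 hneg, apply_le_apply_of_mem_stateSpace hφ ((le_abs_self f).trans h)⟩

theorem abs_apply_le_norm_of_mem_stateSpace {φ : Functional X} (hφ : φ ∈ stateSpace X)
    (f : X →ᵇ ℝ) : |φ f| ≤ ‖f‖ := by
  rw [← apply_const_of_mem_stateSpace hφ ‖f‖]
  exact abs_apply_le_of_mem_stateSpace hφ fun x => f.norm_coe_le_norm x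

theorem convex_stateSpace : Convex ℝ (stateSpace X) := by
  rintro φ ⟨hφ1, hφ⟩ ψ ⟨hψ1, hψ⟩ a b ha hb hab
  refine ⟨?_, fun f hf => add_nonneg (mul_nonneg ha (hφ f hf)) (mul_nonneg hb (hψ f hf))⟩
  change a * φ 1 + b * ψ 1 = 1
  rw [hφ1, hψ1, mul_one, mul_one, hab]

theorem isClosed_stateSpace : IsClosed (stateSpace X) := by
  have heval (f : X →ᵇ ℝ) : Continuous fun φ : Functional X => φ f :=
    WeakDual.eval_continuous f
  simp only [stateSpace, Set.ofPred_and, Set.ofPred_forall]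
  exact (isClosed_eq (heval 1) continuous_const).inter <|
    isClosed_iInter fun f => isClosed_iInter fun _ => isClosed_le continuous_const (heval f)

theorem isCompact_stateSpace : IsCompact (stateSpace X) := by
  refine (WeakDual.isCompact_closedBall (𝕜 := ℝ) (E := X →ᵇ ℝ) 0 1).of_isClosed_subset
    isClosed_stateSpace fun φ hφ => ?_
  rw [Set.mem_preimage, mem_closedBall_zero_iff]
  exact ContinuousLinearMap.opNorm_le_bound _ zero_le_one fun f => by
    simpa using abs_apply_le_norm_of_mem_stateSpace hφ f

/-- Evaluation at a point, the state given by the point mass. -/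
noncomputable def dirac (x : X) : Functional X :=
  StrongDual.toWeakDual (BoundedContinuousFunction.evalCLM ℝ x)

@[simp] theorem dirac_apply (x : X) (f : X →ᵇ ℝ) : dirac x f = f x := rfl

theorem dirac_mem_stateSpace (x : X) : dirac x ∈ stateSpace X :=
  ⟨rfl, fun _ hf => hf x⟩

theorem continuous_dirac : Continuous (dirac (X := X)) :=
  WeakDual.continuous_of_continuous_eval fun f => f.continuous

/-- The function `z ↦ R z a` for a continuous family `R` of states on `Y`, a Markov operator in
`a`. -/
noncomputable def markovOperator (R : C(Z, stateSpace Y)) : (Y →ᵇ ℝ) →L[ℝ] (Z →ᵇ ℝ) :=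
  LinearMap.mkContinuous
    { toFun := fun a => .ofNormedAddCommGroup (fun z => (R z).1 a)
        ((WeakDual.eval_continuous a).comp (continuous_subtype_val.comp R.continuous)) ‖a‖
        fun z => abs_apply_le_norm_of_mem_stateSpace (R z).2 a
      map_add' := fun a b => by ext z; exact map_add (R z).1 a b
      map_smul' := fun c a => by ext z; exact map_smul (R z).1 c a }
    1 fun a => by
      rw [one_mul]
      exact (BoundedContinuousFunction.norm_le (norm_nonneg a)).2 fun z =>
        abs_apply_le_norm_of_mem_stateSpace (R z).2 a

/-- The barycenter `∫ R z dφ(z)` of a continuous family `R` of states, averaged over `φ`. -/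
noncomputable def barycenter (R : C(Z, stateSpace Y)) :
    Functional Z →L[ℝ] Functional Y where
  toFun φ := StrongDual.toWeakDual ((WeakDual.toStrongDual φ).comp (markovOperator R))
  map_add' _ _ := rfl
  map_smul' _ _ := rfl
  cont := WeakDual.continuous_of_continuous_eval fun a =>
    WeakDual.eval_continuous (markovOperator R a)

@[simp] theorem barycenter_apply (R : C(Z, stateSpace Y)) (φ : Functional Z) (a : Y →ᵇ ℝ) :
    barycenter R φ a = φ (markovOperator R a) := rfl

theorem barycenter_mem_stateSpace (R : C(Z, stateSpace Y)) {φ : Functional Z}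
    (hφ : φ ∈ stateSpace Z) : barycenter R φ ∈ stateSpace Y := by
  refine ⟨?_, fun a ha => hφ.2 _ fun z => (R z).2.2 a ha⟩
  rw [barycenter_apply, ← hφ.1]
  congr 1
  ext z
  exact (R z).2.1

/-- The continuous family of point masses `dirac (g z)`; the barycenter along it is the
push-forward of states by `g`. -/
noncomputable def diracComp (g : C(Z, Y)) : C(Z, stateSpace Y) where
  toFun z := ⟨dirac (g z), dirac_mem_stateSpace (g z)⟩
  continuous_toFun := (continuous_dirac.comp g.continuous).subtype_mk _

theorem exists_nonneg_apply_lt_of_mem_nhds_dirac {x : X} {U : Set (Functional X)}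
    (hU : U ∈ 𝓝 (dirac x)) : ∃ f : X →ᵇ ℝ, 0 ≤ f ∧ f x = 0 ∧ ∃ ε > 0,
      ∀ φ ∈ stateSpace X, φ f < ε → φ ∈ U := by
  obtain ⟨s, ε, hε, hsU⟩ := ((WeakDual.withSeminorms ℝ (X →ᵇ ℝ)).mem_nhds_iff _ U).1 hU
  let dev (a : X →ᵇ ℝ) : X →ᵇ ℝ := |a - .const X (a x)|
  refine ⟨∑ a ∈ s, dev a, Finset.sum_nonneg fun a _ => abs_nonneg _, ?_, ε, hε, fun φ hφ hlt => ?_⟩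
  · simp [dev, BoundedContinuousFunction.sum_apply]
  refine hsU ((Seminorm.mem_ball _).2 (Seminorm.finset_sup_apply_lt hε fun a ha => ?_))
  calc ‖φ a - a x‖ = |φ (a - .const X (a x))| := by
        rw [map_sub, apply_const_of_mem_stateSpace hφ, Real.norm_eq_abs]
    _ ≤ φ (dev a) := abs_apply_le_of_mem_stateSpace hφ le_rfl
    _ ≤ φ (∑ a ∈ s, dev a) := apply_le_apply_of_mem_stateSpace hφ <|
        Finset.single_le_sum (f := dev) (fun b _ => abs_nonneg _) ha
    _ < ε := hlt

theorem dirac_mem_extremePoints_stateSpace (x : X) :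
    dirac x ∈ (stateSpace X).extremePoints ℝ := by
  refine ⟨dirac_mem_stateSpace x, ?_⟩
  rintro φ hφ ψ hψ ⟨a, b, ha, hb, -, hab⟩
  refine specializes_iff_eq.1 (specializes_iff_pure.2 fun U hU => ?_)
  obtain ⟨f, hf, hfx, ε, hε, hfU⟩ := exists_nonneg_apply_lt_of_mem_nhds_dirac hU
  have hsum : a * φ f + b * ψ f = 0 := (DFunLike.congr_fun hab f).trans hfx
  have hzero : φ f = 0 := by
    nlinarith [hφ.2 f hf, mul_nonneg hb.le (hψ.2 f hf), mul_nonneg ha.le (hφ.2 f hf)]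
  exact hfU φ hφ (hzero.trans_lt hε)

/-- As point masses are extreme, this is a case of Milman's converse of the Krein–Milman theorem. -/
theorem dirac_mem_closure_of_mem_closure_convexHull {A : Set (Functional X)}
    (hA : A ⊆ stateSpace X) {x : X} (hx : dirac x ∈ closure (convexHull ℝ A)) :
    dirac x ∈ closure A := by
  refine mem_closure_iff_nhds.2 fun U hU => ?_
  obtain ⟨f, -, hfx, ε, hε, hfU⟩ := exists_nonneg_apply_lt_of_mem_nhds_dirac hU
  by_contra hempty
  have hfar : convexHull ℝ A ⊆ {φ | ε ≤ φ f} :=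
    convexHull_min (fun φ hφ => not_lt.1 fun hlt => hempty ⟨φ, hfU φ (hA hφ) hlt, hφ⟩)
      (convex_halfSpace_ge ⟨fun _ _ => rfl, fun _ _ => rfl⟩ ε)
  have hle : ε ≤ dirac x f := closure_minimal hfar
    (isClosed_le continuous_const (WeakDual.eval_continuous f)) hx
  rw [dirac_apply, hfx] at hle
  exact hle.not_gt hε

theorem apply_mul_of_mem_extremePoints_stateSpace {φ : Functional X}
    (hφ : φ ∈ (stateSpace X).extremePoints ℝ) (f g : X →ᵇ ℝ) : φ (f * g) = φ f * φ g := by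
  have hS := hφ.1
  -- `φ` is the midpoint of the states `φ ± c (φ (f ·) - φ f φ)`.
  let T (t : ℝ) : (X →ᵇ ℝ) →L[ℝ] (X →ᵇ ℝ) :=
    .id ℝ _ + t • (ContinuousLinearMap.mul ℝ _ f - φ f • .id ℝ _)
  let ψ (t : ℝ) : Functional X := StrongDual.toWeakDual ((WeakDual.toStrongDual φ).comp (T t))
  have hψ (t : ℝ) (h : X →ᵇ ℝ) : ψ t h = φ h + t * (φ (f * h) - φ f * φ h) := by
    change WeakDual.toStrongDual φ (h + t • (f * h - φ f • h)) = _
    simp only [map_add, map_smul, map_sub, smul_eq_mul]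
    rfl
  let c : ℝ := (2 * ‖f‖ + 1)⁻¹
  have hc : 0 < c := by positivity
  have hψS (t : ℝ) (ht : |t| = c) : ψ t ∈ stateSpace X := by
    refine ⟨by rw [hψ, mul_one, hS.1]; ring, fun h hh => hS.2 _ fun x => ?_⟩
    have hdev : |t * (f x - φ f)| ≤ 1 := by
      rw [abs_mul, ht, ← div_eq_inv_mul, div_le_one (by positivity)]
      linarith [abs_sub (f x) (φ f), f.norm_coe_le_norm x, Real.norm_eq_abs (f x),
        abs_apply_le_norm_of_mem_stateSpace hS f]
    calc 0 ≤ h x * (t * (f x - φ f) + 1) :=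
          mul_nonneg (hh x) (neg_le_iff_add_nonneg.1 (abs_le.1 hdev).1)
      _ = h x + t * (f x * h x - φ f * h x) := by ring
  have hmid : φ ∈ openSegment ℝ (ψ c) (ψ (-c)) := by
    refine ⟨2⁻¹, 2⁻¹, by norm_num, by norm_num, by norm_num, DFunLike.ext _ _ fun h => ?_⟩
    change 2⁻¹ * ψ c h + 2⁻¹ * ψ (-c) h = φ h
    rw [hψ, hψ]
    ring
  have hψφ : ψ c = φ :=
    hφ.2 (hψS c (abs_of_pos hc)) (hψS (-c) (by rw [abs_neg, abs_of_pos hc])) hmid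
  have hzero : φ g + c * (φ (f * g) - φ f * φ g) = φ g := by rw [← hψ, hψφ]
  exact sub_eq_zero.1 ((mul_eq_zero.1 (add_eq_left.1 hzero)).resolve_left hc.ne')

theorem subset_of_extremePoints_subset {K C : Set (Functional X)} (hK : IsCompact K)
    (hKconvex : Convex ℝ K) (hC : IsClosed C) (hCconvex : Convex ℝ C)
    (h : K.extremePoints ℝ ⊆ C) : K ⊆ C :=
  (closure_convexHull_extremePoints hK hKconvex).symm.subset.trans
    (closure_minimal (convexHull_min h hCconvex) hC)

section CompactHausdorff

variable [CompactSpace X] [T2Space X]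

theorem dirac_injective : Function.Injective (dirac (X := X)) := by
  intro x y hxy
  by_contra hne
  obtain ⟨f, hfx, hfy, -⟩ := exists_bounded_zero_one_of_closed (isClosed_singleton (x := x))
    (isClosed_singleton (x := y)) (by simpa using hne)
  have hf : f x = f y := congrArg (· f) hxy
  rw [hfx rfl, hfy rfl] at hf
  exact zero_ne_one hf

theorem isClosedEmbedding_dirac : IsClosedEmbedding (dirac (X := X)) :=
  continuous_dirac.isClosedEmbedding dirac_injective

theorem extremePoints_stateSpace_subset_range_dirac :
    (stateSpace X).extremePoints ℝ ⊆ Set.range dirac := by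
  intro φ hφ
  let e := ContinuousMap.linearIsometryBoundedOfCompact X ℝ ℝ
  let χ : WeakDual.characterSpace ℝ C(X, ℝ) :=
    ⟨StrongDual.toWeakDual
        ((WeakDual.toStrongDual φ).comp e.toContinuousLinearEquiv.toContinuousLinearMap),
      fun h => one_ne_zero (α := ℝ) (hφ.1.1.symm.trans (DFunLike.congr_fun h 1)),
      fun f g => apply_mul_of_mem_extremePoints_stateSpace hφ (e f) (e g)⟩
  obtain ⟨x, hx⟩ := (WeakDual.CharacterSpace.continuousMapEval_bijective X ℝ).2 χ
  exact ⟨x, DFunLike.ext _ _ fun f => congrArg (fun χ => χ.1 f.toContinuousMap) hx⟩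

theorem barycenter_mem_of_convex (R : C(X, stateSpace Y)) {Q : Set (Functional Y)}
    (hQ : IsClosed Q) (hQc : Convex ℝ Q) (hR : ∀ x, (R x : Functional Y) ∈ Q) {φ : Functional X}
    (hφ : φ ∈ stateSpace X) : barycenter R φ ∈ Q := by
  refine subset_of_extremePoints_subset isCompact_stateSpace convex_stateSpace
    (hQ.preimage (barycenter R).continuous) (hQc.linear_preimage (barycenter R).toLinearMap) ?_ hφ
  intro ψ hψ
  obtain ⟨x, rfl⟩ := extremePoints_stateSpace_subset_range_dirac hψ
  exact hR x

theorem eq_dirac_of_barycenter_eq_extremePoint {R : C(X, stateSpace Y)}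
    (hRinj : Function.Injective R) {Q : Set (Functional Y)} (hQ : IsClosed Q)
    (hQc : Convex ℝ Q) (hRQ : ∀ x, (R x : Functional Y) ∈ Q) {x : X}
    (hx : (R x : Functional Y) ∈ Q.extremePoints ℝ) {φ : Functional X}
    (hφ : φ ∈ stateSpace X) (hφx : barycenter R φ = R x) : φ = dirac x := by
  let F : Set (Functional X) := stateSpace X ∩ barycenter R ⁻¹' {(R x).1}
  have hFext : IsExtreme ℝ (stateSpace X) F := by
    refine ⟨Set.inter_subset_left, ?_⟩
    rintro ψ₁ h₁ ψ₂ h₂ _ hψ ⟨a, b, ha, hb, hab, rfl⟩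
    have hseg : a • barycenter R ψ₁ + b • barycenter R ψ₂ = R x := hψ.2
    refine ⟨h₁, ?_⟩
    exact hx.2 (barycenter_mem_of_convex R hQ hQc hRQ h₁)
      (barycenter_mem_of_convex R hQ hQc hRQ h₂) ⟨a, b, ha, hb, hab, hseg⟩
  have hFcompact : IsCompact F := isCompact_stateSpace.inter_right
    (isClosed_singleton.preimage (barycenter R).continuous)
  have hFconvex : Convex ℝ F := convex_stateSpace.inter
    ((convex_singleton _).linear_preimage (barycenter R).toLinearMap)
  have hFdirac : F.extremePoints ℝ ⊆ {dirac x} := by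
    intro ψ hψ
    obtain ⟨y, rfl⟩ := extremePoints_stateSpace_subset_range_dirac
      (hFext.extremePoints_subset_extremePoints hψ)
    rw [hRinj (Subtype.ext hψ.1.2)]
    rfl
  exact subset_of_extremePoints_subset hFcompact hFconvex isClosed_singleton (convex_singleton _)
    hFdirac ⟨hφ, hφx⟩

end CompactHausdorff

end States

section Contraction

variable {G X : Type*} [Group G] [TopologicalSpace X] [MulAction G X] [ContinuousConstSMul G X]

/-- A group acting on `X` acts on functionals by push-forward: `(s • φ) f = φ (f (s • ·))`. -/
noncomputable scoped instance : DistribMulAction G (Functional X) where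
  smul s := barycenter (diracComp ⟨(s • ·), continuous_const_smul s⟩)
  one_smul φ := DFunLike.ext _ _ fun f => congrArg φ <| by ext x; exact congrArg f (one_smul G x)
  mul_smul s t φ := DFunLike.ext _ _ fun f => congrArg φ <| by
    ext x; exact congrArg f (mul_smul s t x)
  smul_zero _ := map_zero (barycenter _)
  smul_add _ := map_add (barycenter _)

scoped instance : ContinuousConstSMul G (Functional X) :=
  ⟨fun _ => (barycenter _).continuous⟩

scoped instance : SMulCommClass G ℝ (Functional X) :=
  ⟨fun _ => map_smul (barycenter _)⟩

theorem smul_apply (s : G) (φ : Functional X) (f : X →ᵇ ℝ) :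
    (s • φ) f = φ (f.compContinuous ⟨(s • ·), continuous_const_smul s⟩) := rfl

theorem smul_dirac (s : G) (x : X) : s • dirac x = dirac (s • x) := rfl

theorem smul_mem_stateSpace (s : G) {φ : Functional X} (hφ : φ ∈ stateSpace X) :
    s • φ ∈ stateSpace X := barycenter_mem_stateSpace _ hφ

theorem barycenter_smul {Z : Type*} [TopologicalSpace Z] [MulAction G Z] [ContinuousConstSMul G Z]
    {R : C(Z, stateSpace X)} (hR : ∀ (s : G) z, (R (s • z) : Functional X) = s • (R z).1) (s : G)
    (φ : Functional Z) : barycenter R (s • φ) = s • barycenter R φ :=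
  DFunLike.ext _ _ fun f => congrArg φ <| by ext z; exact DFunLike.congr_fun (hR s z) f

/-- The contraction property: every state can be pushed arbitrarily close to every point mass.
On compact Hausdorff spaces it is minimality together with strong proximality. -/
def Contracts (G X : Type*) [Group G] [TopologicalSpace X] [MulAction G X]
    [ContinuousConstSMul G X] : Prop :=
  ∀ φ ∈ stateSpace X, ∀ x : X, dirac x ∈ closure (MulAction.orbit G φ)

theorem closure_orbit_subset {V : Type*} [TopologicalSpace V] [MulAction G V] {K : Set V}
    (hK : IsClosed K) (hinv : ∀ s : G, ∀ v ∈ K, s • v ∈ K) {v : V} (hv : v ∈ K) :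
    closure (MulAction.orbit G v) ⊆ K :=
  closure_minimal (Set.range_subset_iff.2 fun s => hinv s v hv) hK

theorem Contracts.isMinimal [CompactSpace X] [T2Space X] (h : Contracts G X) :
    MulAction.IsMinimal G X := by
  refine ⟨fun y x => ?_⟩
  rw [isClosedEmbedding_dirac.isInducing.closure_eq_preimage_closure_image, Set.mem_preimage,
    MulAction.orbit, ← Set.range_comp]
  exact h (dirac y) (dirac_mem_stateSpace y) x

section Measures

variable [MeasurableSpace X]

/-- Integration against a probability measure. -/
noncomputable def integralState [OpensMeasurableSpace X] (ν : ProbabilityMeasure X) :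
    Functional X :=
  StrongDual.toWeakDual <| LinearMap.mkContinuous
    { toFun := fun f => ∫ x, f x ∂(ν : Measure X)
      map_add' := fun f g => integral_add (f.integrable _) (g.integrable _)
      map_smul' := fun c f => integral_const_mul c f }
    1 fun f => by simpa using f.norm_integral_le_norm (ν : Measure X)

theorem integralState_apply [OpensMeasurableSpace X] (ν : ProbabilityMeasure X) (f : X →ᵇ ℝ) :
    integralState ν f = ∫ x, f x ∂(ν : Measure X) := rfl

theorem isInducing_integralState [OpensMeasurableSpace X] :
    IsInducing (integralState (X := X)) := by
  refine isInducing_iff_nhds.2 fun ν => le_antisymm (Filter.tendsto_iff_comap.1 ?_) ?_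
  · exact (WeakDual.continuous_of_continuous_eval fun f =>
      ProbabilityMeasure.continuous_integral_boundedContinuousFunction f).tendsto ν
  · have h : Filter.Tendsto id (Filter.comap integralState (𝓝 (integralState ν))) (𝓝 ν) :=
      ProbabilityMeasure.tendsto_iff_forall_integral_tendsto.2 fun f =>
        ((WeakDual.eval_continuous f).tendsto (integralState ν)).comp Filter.tendsto_comap
    exact h

theorem integralState_mem_stateSpace [OpensMeasurableSpace X] (ν : ProbabilityMeasure X) :
    integralState ν ∈ stateSpace X :=
  ⟨by simp [integralState_apply], fun _ hf => integral_nonneg hf⟩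

theorem integralState_diracProba [OpensMeasurableSpace X] (x : X) :
    integralState (diracProba x) = dirac x :=
  DFunLike.ext (integralState (diracProba x)) (dirac x) fun f =>
    integral_dirac' f x f.continuous.stronglyMeasurable

variable [BorelSpace X]

theorem integralState_image_orbit (ν : ProbabilityMeasure X) :
    integralState '' {μ : ProbabilityMeasure X |
      ∃ s : G, (μ : Measure X) = (ν : Measure X).map (fun y => s • y)} =
    MulAction.orbit G (integralState ν) := by
  have hsmul (s : G) : Measurable fun y : X => s • y := (continuous_const_smul s).measurable
  have hint (s : G) {μ : ProbabilityMeasure X}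
      (hμ : (μ : Measure X) = (ν : Measure X).map (fun y => s • y)) :
      s • integralState ν = integralState μ := DFunLike.ext _ _ fun f => by
    rw [integralState_apply, hμ,
      integral_map (hsmul s).aemeasurable f.continuous.aestronglyMeasurable]
    rfl
  refine Set.Subset.antisymm ?_ ?_
  · rintro _ ⟨μ, ⟨s, hμ⟩, rfl⟩
    exact ⟨s, hint s hμ⟩
  · rintro _ ⟨s, rfl⟩
    exact ⟨ν.map (hsmul s).aemeasurable, ⟨s, rfl⟩, (hint s rfl).symm⟩

theorem exists_regular_integralState_eq [CompactSpace X] [T2Space X] {φ : Functional X}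
    (hφ : φ ∈ stateSpace X) :
    ∃ ν : ProbabilityMeasure X, (ν : Measure X).Regular ∧ integralState ν = φ := by
  let Λ : CompactlySupportedContinuousMap X ℝ →ₚ[ℝ] ℝ := PositiveLinearMap.mk₀
    { toFun := fun f => φ (.mkOfCompact f.toContinuousMap)
      map_add' := fun f g =>
        map_add φ (.mkOfCompact f.toContinuousMap) (.mkOfCompact g.toContinuousMap)
      map_smul' := fun c f => map_smul φ c (.mkOfCompact f.toContinuousMap) }
    fun f hf => hφ.2 _ hf
  let μ := RealRMK.rieszMeasure Λ
  have hint (f : X →ᵇ ℝ) : ∫ x, f x ∂μ = φ f :=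
    RealRMK.integral_rieszMeasure Λ
      (CompactlySupportedContinuousMap.continuousMapEquiv f.toContinuousMap)
  have : IsFiniteMeasure μ := ⟨isCompact_univ.measure_lt_top⟩
  have hμ : μ.real Set.univ = 1 := by simpa [hφ.1] using hint 1
  exact ⟨⟨μ, ⟨(ENNReal.toReal_eq_one_iff _).1 hμ⟩⟩, inferInstanceAs μ.Regular,
    DFunLike.ext _ _ hint⟩

end Measures

theorem isStronglyProximal_iff [CompactSpace X] [T2Space X] : IsStronglyProximal G X ↔
    ∀ φ ∈ stateSpace X, ∃ x, dirac x ∈ closure (MulAction.orbit G φ) := by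
  have hclosure [MeasurableSpace X] [BorelSpace X] (ν : ProbabilityMeasure X) (x : X) :
      diracProba x ∈ closure {μ : ProbabilityMeasure X |
        ∃ s : G, (μ : Measure X) = (ν : Measure X).map (fun y => s • y)} ↔
      dirac x ∈ closure (MulAction.orbit G (integralState ν)) := by
    rw [isInducing_integralState.closure_eq_preimage_closure_image, Set.mem_preimage,
      integralState_image_orbit, integralState_diracProba]
  constructor
  · intro h φ hφ
    borelize X
    obtain ⟨ν, hν, rfl⟩ := exists_regular_integralState_eq hφ
    exact (h ν hν).imp fun x => (hclosure ν x).1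
  · intro h _ _ ν _
    exact (h _ (integralState_mem_stateSpace ν)).imp fun x => (hclosure ν x).2

theorem IsBoundary.contracts (h : IsBoundary G X) : Contracts G X := by
  have := h.compactSpace
  have := h.t2Space
  have := h.isMinimal
  intro φ hφ x
  obtain ⟨y, hy⟩ := isStronglyProximal_iff.1 h.isStronglyProximal φ hφ
  have hxy : dirac x ∈ closure (MulAction.orbit G (dirac y)) :=
    map_mem_closure continuous_dirac (MulAction.dense_orbit G y x)
      (by rintro _ ⟨s, rfl⟩; exact ⟨s, rfl⟩)
  exact closure_orbit_subset isClosed_closure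
    (fun s ψ hψ => smul_closure_orbit_subset s φ ⟨ψ, hψ, rfl⟩) hy hxy

theorem Contracts.isBoundary [Nonempty X] [CompactSpace X] [T2Space X] (h : Contracts G X) :
    IsBoundary G X where
  nonempty := ‹_›
  compactSpace := ‹_›
  t2Space := ‹_›
  continuousConstSMul := ‹_›
  isMinimal := h.isMinimal
  isStronglyProximal := isStronglyProximal_iff.2 fun φ hφ =>
    ⟨Classical.arbitrary X, h φ hφ _⟩

end Contraction

section Rigidity

variable {G B Z : Type*} [Group G] [TopologicalSpace B] [MulAction G B] [ContinuousConstSMul G B]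
  [TopologicalSpace Z] [MulAction G Z]

theorem Contracts.exists_eq_dirac [CompactSpace Z] [Nonempty Z] (h : Contracts G B)
    {R : C(Z, stateSpace B)} (hR : ∀ (s : G) z, (R (s • z) : Functional B) = s • (R z).1) (b : B) :
    ∃ z, (R z : Functional B) = dirac b := by
  have hclosed : IsClosed (Set.range fun z => (R z : Functional B)) :=
    (isCompact_range (continuous_subtype_val.comp R.continuous)).isClosed
  exact closure_orbit_subset hclosed (by rintro s _ ⟨z, rfl⟩; exact ⟨s • z, hR s z⟩)
    (Set.mem_range_self (Classical.arbitrary Z)) (h _ (R _).2 b)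

variable [CompactSpace B] [T2Space B]

open scoped Pointwise in
theorem Contracts.exists_map_of_equivariant [CompactSpace Z] [Nonempty Z]
    [ContinuousConstSMul G Z] [MulAction.IsMinimal G Z] [Nonempty B] (h : Contracts G B)
    {R : C(Z, stateSpace B)} (hR : ∀ (s : G) z, (R (s • z) : Functional B) = s • (R z).1) :
    ∃ f : Z → B, Continuous f ∧ (∀ (s : G) z, f (s • z) = s • f z) ∧ Function.Surjective f ∧
      ∀ z, (R z : Functional B) = dirac (f z) := by
  let D : Set Z := {z | (R z : Functional B) ∈ Set.range dirac}
  have hDclosed : IsClosed D := isClosedEmbedding_dirac.isClosed_range.preimage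
    (continuous_subtype_val.comp R.continuous)
  have hDinv (s : G) : s • D ⊆ D := by
    rintro _ ⟨z, ⟨b, hb⟩, rfl⟩
    exact ⟨s • b, by rw [← smul_dirac, hb]; exact (hR s z).symm⟩
  have hDne : D ≠ ∅ := by
    obtain ⟨z, hz⟩ := h.exists_eq_dirac hR (Classical.arbitrary B)
    exact Set.Nonempty.ne_empty ⟨z, _, hz.symm⟩
  have hD : D = Set.univ :=
    (eq_empty_or_univ_of_smul_invariant_closed G hDclosed hDinv).resolve_left hDne
  choose f hf using fun z => hD.ge (Set.mem_univ z)
  refine ⟨f, ?_, fun s z => dirac_injective ?_, fun b => ?_, fun z => (hf z).symm⟩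
  · rw [isClosedEmbedding_dirac.isInducing.continuous_iff]
    exact (continuous_subtype_val.comp R.continuous).congr fun z => (hf z).symm
  · rw [hf, hR, ← hf, smul_dirac]
  · obtain ⟨z, hz⟩ := h.exists_eq_dirac hR b
    exact ⟨z, dirac_injective ((hf z).trans hz)⟩

theorem Contracts.eq_dirac_of_equivariant (h : Contracts G B) {R : C(B, stateSpace B)}
    (hR : ∀ (s : G) b, (R (s • b) : Functional B) = s • (R b).1) (b : B) :
    (R b : Functional B) = dirac b := by
  have : Nonempty B := ⟨b⟩
  have := h.isMinimal
  let P : C(B, stateSpace B) :=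
    { toFun := fun x => ⟨(2⁻¹ : ℝ) • (R x).1 + (2⁻¹ : ℝ) • dirac x,
        convex_stateSpace (R x).2 (dirac_mem_stateSpace x) (by norm_num) (by norm_num)
          (by norm_num)⟩
      continuous_toFun := (((continuous_subtype_val.comp R.continuous).const_smul (2⁻¹ : ℝ)).add
        (continuous_dirac.const_smul (2⁻¹ : ℝ))).subtype_mk _ }
  have hP (s : G) (x : B) : (P (s • x) : Functional B) = s • (P x).1 := by
    change (2⁻¹ : ℝ) • (R (s • x)).1 + (2⁻¹ : ℝ) • dirac (s • x) =
      s • ((2⁻¹ : ℝ) • (R x).1 + (2⁻¹ : ℝ) • dirac x)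
    rw [hR, ← smul_dirac, smul_add, smul_comm s, smul_comm s]
  obtain ⟨f, -, -, -, hf⟩ := h.exists_map_of_equivariant hP
  obtain ⟨hRb, hb⟩ := (mem_extremePoints.1 (dirac_mem_extremePoints_stateSpace (f b))).2
    (R b) (R b).2 (dirac b) (dirac_mem_stateSpace b)
    ⟨2⁻¹, 2⁻¹, by norm_num, by norm_num, by norm_num, hf b⟩
  exact hRb.trans hb.symm

theorem Contracts.subsingleton_of_forall_smul_eq (h : Contracts G B) {φ : Functional B}
    (hφ : φ ∈ stateSpace B) (hfix : ∀ s : G, s • φ = φ) : Subsingleton B := by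
  have hclosure : closure (MulAction.orbit G φ) ⊆ {φ} :=
    closure_orbit_subset isClosed_singleton (by rintro s _ rfl; exact hfix s) rfl
  exact ⟨fun x y => dirac_injective ((hclosure (h φ hφ x)).trans (hclosure (h φ hφ y)).symm)⟩

theorem Contracts.subsingleton_of_isOpen_singleton (h : Contracts G B) {x : B}
    (hx : IsOpen {x}) : Subsingleton B := by
  suffices ∀ y, x = y from ⟨fun y z => (this y).symm.trans (this z)⟩
  intro y
  obtain ⟨f, hfx, hf1, hf⟩ := exists_bounded_zero_one_of_closed (isClosed_singleton (x := x))
    hx.isClosed_compl disjoint_compl_right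
  have hφ : (2⁻¹ : ℝ) • dirac x + (2⁻¹ : ℝ) • dirac y ∈ stateSpace B :=
    convex_stateSpace (dirac_mem_stateSpace x) (dirac_mem_stateSpace y) (by norm_num)
      (by norm_num) (by norm_num)
  have hnhds : {ψ : Functional B | ψ f < 2⁻¹} ∈ 𝓝 (dirac x) :=
    (isOpen_lt (WeakDual.eval_continuous f) continuous_const).mem_nhds (by
      rw [Set.mem_ofPred_eq, dirac_apply, hfx rfl]; norm_num)
  obtain ⟨_, hψ, s, rfl⟩ := mem_closure_iff_nhds.1 (h _ hφ x) _ hnhds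
  have hlt : 2⁻¹ * f (s • x) + 2⁻¹ * f (s • y) < (2⁻¹ : ℝ) := hψ
  have hsx : s • x = x := by
    by_contra hne
    have hf1x : f (s • x) = 1 := hf1 hne
    linarith [(hf (s • y)).1]
  have hsy : s • y = x := by
    by_contra hne
    have hf1y : f (s • y) = 1 := hf1 hne
    linarith [(hf (s • x)).1]
  exact MulAction.injective s (hsx.trans hsy.symm)

end Rigidity

section AffineFlows

variable {G V W : Type*} [Group G] [AddCommGroup V] [Module ℝ V] [TopologicalSpace V]
  [DistribMulAction G V] [AddCommGroup W] [Module ℝ W] [TopologicalSpace W]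
  [DistribMulAction G W]

variable (G) in
/-- A nonempty compact convex set that is invariant under a linear action of `G`. Its minimal
instances are the irreducible affine flows of Glasner. -/
structure IsAffineFlow (Q : Set V) : Prop where
  nonempty : Q.Nonempty
  isCompact : IsCompact Q
  convex : Convex ℝ Q
  smul_mem : ∀ (s : G) {v : V}, v ∈ Q → s • v ∈ Q

theorem IsAffineFlow.exists_minimal [T2Space V] {S : Set V} (hS : IsAffineFlow G S) :
    ∃ Q ⊆ S, Minimal (IsAffineFlow G) Q := by
  refine zorn_superset_nonempty {Q | IsAffineFlow G Q} (fun c hc hchain hne => ?_) S hS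
  refine ⟨⋂₀ c, ⟨?_, ?_, convex_sInter fun Q hQ => (hc hQ).convex,
    fun s v hv Q hQ => (hc hQ).smul_mem s (hv Q hQ)⟩, fun Q hQ => Set.sInter_subset_of_mem hQ⟩
  · have : Nonempty c := hne.to_subtype
    have hdirected : DirectedOn (· ⊇ ·) c := fun P hP Q hQ => (hchain.total hP hQ).elim
      (fun h => ⟨P, hP, subset_rfl, h⟩) fun h => ⟨Q, hQ, h, subset_rfl⟩
    exact IsCompact.nonempty_sInter_of_directed_nonempty_isCompact_isClosed
      hdirected (fun Q hQ => (hc hQ).nonempty) (fun Q hQ => (hc hQ).isCompact)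
      fun Q hQ => (hc hQ).isCompact.isClosed
  · obtain ⟨Q, hQ⟩ := hne
    exact (hc hQ).isCompact.of_isClosed_subset
      (isClosed_sInter fun P hP => (hc hP).isCompact.isClosed) (Set.sInter_subset_of_mem hQ)

theorem IsAffineFlow.image {Q : Set V} (hQ : IsAffineFlow G Q) (L : V →L[ℝ] W)
    (hL : ∀ (s : G) v, L (s • v) = s • L v) : IsAffineFlow G (L '' Q) where
  nonempty := hQ.nonempty.image L
  isCompact := hQ.isCompact.image L.continuous
  convex := hQ.convex.linear_image L.toLinearMap
  smul_mem s := by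
    rintro _ ⟨v, hv, rfl⟩
    exact ⟨s • v, hQ.smul_mem s hv, hL s v⟩

variable [SMulCommClass G ℝ V]

theorem IsAffineFlow.closedConvexHull_orbit [T2Space V] [ContinuousConstSMul G V] {S : Set V}
    (hS : IsAffineFlow G S) {v : V} (hv : v ∈ S) :
    IsAffineFlow G (closedConvexHull ℝ (MulAction.orbit G v)) where
  nonempty := ⟨v, subset_closedConvexHull (MulAction.mem_orbit_self v)⟩
  isCompact := hS.isCompact.of_isClosed_subset isClosed_closedConvexHull
    (closedConvexHull_min (Set.range_subset_iff.2 fun s => hS.smul_mem s hv) hS.convex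
      hS.isCompact.isClosed)
  convex := convex_closedConvexHull
  smul_mem s := by
    refine fun hw => closedConvexHull_min ?_
      (convex_closedConvexHull.linear_preimage (DistribSMul.toLinearMap ℝ V s))
      (isClosed_closedConvexHull.preimage (continuous_const_smul s)) hw
    rintro _ ⟨t, rfl⟩
    exact subset_closedConvexHull ⟨s * t, mul_smul s t v⟩

theorem IsAffineFlow.smul_mem_extremePoints {Q : Set V} (hQ : IsAffineFlow G Q) (s : G) {q : V}
    (hq : q ∈ Q.extremePoints ℝ) : s • q ∈ Q.extremePoints ℝ := by
  refine ⟨hQ.smul_mem s hq.1, ?_⟩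
  rintro v hv w hw ⟨a, b, ha, hb, hab, hvw⟩
  have hmid : q ∈ openSegment ℝ (s⁻¹ • v) (s⁻¹ • w) := by
    refine ⟨a, b, ha, hb, hab, ?_⟩
    rw [← smul_comm s⁻¹ a, ← smul_comm s⁻¹ b, ← smul_add, hvw, inv_smul_smul]
  rw [← hq.2 (hQ.smul_mem s⁻¹ hv) (hQ.smul_mem s⁻¹ hw) hmid, smul_inv_smul]

/-- The closure of the extreme points of an affine flow, as a flow. -/
def IsAffineFlow.extremeFlow [ContinuousConstSMul G V] {Q : Set V} (hQ : IsAffineFlow G Q) :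
    SubMulAction G V where
  carrier := closure (Q.extremePoints ℝ)
  smul_mem' s _ hv := map_mem_closure (continuous_const_smul s) hv
    fun _ hq => hQ.smul_mem_extremePoints s hq

theorem IsAffineFlow.extremeFlow_subset [T2Space V] [ContinuousConstSMul G V] {Q : Set V}
    (hQ : IsAffineFlow G Q) : (hQ.extremeFlow : Set V) ⊆ Q :=
  closure_minimal extremePoints_subset hQ.isCompact.isClosed

instance continuousConstSMul_subMulAction [ContinuousConstSMul G V] (M : SubMulAction G V) :
    ContinuousConstSMul G M :=
  ⟨fun s => ((continuous_const_smul s).comp continuous_subtype_val).subtype_mk _⟩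

end AffineFlows

section Existence

variable {G Y : Type*} [Group G] [TopologicalSpace Y] [MulAction G Y] [ContinuousConstSMul G Y]

theorem isAffineFlow_stateSpace [Nonempty Y] : IsAffineFlow G (stateSpace Y) where
  nonempty := ⟨_, dirac_mem_stateSpace (Classical.arbitrary Y)⟩
  isCompact := isCompact_stateSpace
  convex := convex_stateSpace
  smul_mem := smul_mem_stateSpace

theorem nonempty_extremeFlow {Q : Set (Functional Y)} (hQ : IsAffineFlow G Q) :
    Nonempty hQ.extremeFlow :=
  (hQ.isCompact.extremePoints_nonempty hQ.nonempty).closure.to_subtype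

theorem compactSpace_extremeFlow {Q : Set (Functional Y)} (hQ : IsAffineFlow G Q) :
    CompactSpace hQ.extremeFlow :=
  isCompact_iff_compactSpace.1
    (hQ.isCompact.of_isClosed_subset isClosed_closure hQ.extremeFlow_subset)

theorem contracts_extremeFlow {Q : Set (Functional Y)} (hQ : Minimal (IsAffineFlow G) Q)
    (hQS : Q ⊆ stateSpace Y) : Contracts G hQ.prop.extremeFlow := by
  have hMQ := hQ.prop.extremeFlow_subset
  have := nonempty_extremeFlow hQ.prop
  have := compactSpace_extremeFlow hQ.prop
  let R : C(hQ.prop.extremeFlow, stateSpace Y) :=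
    ⟨fun q => ⟨q, hQS (hMQ q.2)⟩, continuous_subtype_val.subtype_mk _⟩
  have hRinj : Function.Injective R := fun p q h =>
    Subtype.ext (congrArg (fun ψ : stateSpace Y => ψ.1) h)
  intro φ hφ
  have hK : IsAffineFlow G (closedConvexHull ℝ (MulAction.orbit G φ)) :=
    isAffineFlow_stateSpace.closedConvexHull_orbit hφ
  have hKS : closedConvexHull ℝ (MulAction.orbit G φ) ⊆ stateSpace _ :=
    closedConvexHull_min (Set.range_subset_iff.2 fun s => smul_mem_stateSpace s hφ)
      convex_stateSpace isClosed_stateSpace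
  have himage : Q ⊆ barycenter R '' closedConvexHull ℝ (MulAction.orbit G φ) :=
    hQ.le_of_le (hK.image _ (barycenter_smul fun _ _ => rfl)) <| Set.image_subset_iff.2 fun ψ hψ =>
      barycenter_mem_of_convex R hQ.prop.isCompact.isClosed hQ.prop.convex (fun q => hMQ q.2)
        (hKS hψ)
  have hext (q : hQ.prop.extremeFlow) (hq : (q : Functional Y) ∈ Q.extremePoints ℝ) :
      dirac q ∈ closure (MulAction.orbit G φ) := by
    obtain ⟨ψ, hψ, hψq⟩ := himage hq.1
    rw [eq_dirac_of_barycenter_eq_extremePoint hRinj hQ.prop.isCompact.isClosed hQ.prop.convex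
      (fun q => hMQ q.2) (x := q) hq (hKS hψ) hψq, closedConvexHull_eq_closure_convexHull] at hψ
    exact dirac_mem_closure_of_mem_closure_convexHull
      (Set.range_subset_iff.2 fun s => smul_mem_stateSpace s hφ) hψ
  have hdense (x : hQ.prop.extremeFlow) :
      x ∈ closure {q : hQ.prop.extremeFlow | (q : Functional Y) ∈ Q.extremePoints ℝ} := by
    refine closure_subtype.2 (closure_mono (fun q hq => ?_) x.2)
    exact ⟨⟨q, subset_closure hq⟩, hq, rfl⟩
  exact fun x => closure_minimal hext (isClosed_closure.preimage continuous_dirac) (hdense x)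

end Existence

section Universality

variable {G : Type u} [Group G] [TopologicalSpace G] [DiscreteTopology G]
  {B : Type*} [TopologicalSpace B] [MulAction G B] [ContinuousConstSMul G B]

/-- The orbit map `s ↦ s • b` as a continuous family of point masses; the barycenter along it
pushes means on `G` to states on `B`. -/
noncomputable def orbitStates (b : B) : C(G, stateSpace B) :=
  diracComp ⟨(· • b), continuous_of_discreteTopology⟩

theorem barycenter_orbitStates_smul (b : B) (s : G) (φ : Functional G) :
    barycenter (orbitStates b) (s • φ) = s • barycenter (orbitStates b) φ :=
  barycenter_smul (fun s t => congrArg dirac (mul_smul s t b)) s φ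

/-- A continuous family of means on `G`, pushed to `B` along the orbit map of `b`. -/
noncomputable def pushStates {Z : Type*} [TopologicalSpace Z] (F : C(Z, stateSpace G)) (b : B) :
    C(Z, stateSpace B) where
  toFun z := ⟨barycenter (orbitStates b) (F z).1, barycenter_mem_stateSpace _ (F z).2⟩
  continuous_toFun := ((barycenter (orbitStates b)).continuous.comp
    (continuous_subtype_val.comp F.continuous)).subtype_mk _

theorem pushStates_smul {Z : Type*} [TopologicalSpace Z] [MulAction G Z] {F : C(Z, stateSpace G)}
    (hF : ∀ (s : G) z, (F (s • z) : Functional G) = s • (F z).1) (b : B) (s : G) (z : Z) :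
    (pushStates F b (s • z) : Functional B) = s • (pushStates F b z).1 :=
  (congrArg (barycenter (orbitStates b)) (hF s z)).trans (barycenter_orbitStates_smul b s _)

theorem IsBoundary.isFurstenbergBoundary {X : Type u} [TopologicalSpace X] [MulAction G X]
    (hX : IsBoundary G X) {F : C(X, stateSpace G)}
    (hF : ∀ (s : G) x, (F (s • x) : Functional G) = s • (F x).1) : IsFurstenbergBoundary G X where
  isBoundary := hX
  universal B _ _ hB := by
    obtain ⟨_, _, _, _, _, -⟩ := hX
    obtain ⟨⟨b⟩, _, _, _, _, -⟩ := id hB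
    have : Nonempty B := ⟨b⟩
    obtain ⟨f, hf, hfG, hfsurj, -⟩ :=
      hB.contracts.exists_map_of_equivariant (pushStates_smul hF b)
    exact ⟨f, hf, hfG, hfsurj⟩

variable (G) in
theorem exists_isFurstenbergBoundary_map_stateSpace :
    ∃ (X : Type u) (_ : TopologicalSpace X) (_ : MulAction G X), IsFurstenbergBoundary G X ∧
      ∃ F : C(X, stateSpace G), ∀ (s : G) x, (F (s • x) : Functional G) = s • (F x).1 := by
  obtain ⟨Q, hQS, hQ⟩ := (isAffineFlow_stateSpace (G := G) (Y := G)).exists_minimal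
  have := nonempty_extremeFlow hQ.prop
  have := compactSpace_extremeFlow hQ.prop
  let F : C(hQ.prop.extremeFlow, stateSpace G) :=
    ⟨fun q => ⟨q, hQS (hQ.prop.extremeFlow_subset q.2)⟩, continuous_subtype_val.subtype_mk _⟩
  have hF (s : G) q : (F (s • q) : Functional G) = s • (F q).1 := rfl
  exact ⟨hQ.prop.extremeFlow, inferInstance, inferInstance,
    (contracts_extremeFlow hQ hQS).isBoundary.isFurstenbergBoundary hF, F, hF⟩

variable {X : Type u} [TopologicalSpace X] [MulAction G X]

theorem IsFurstenbergBoundary.exists_map_stateSpace (hX : IsFurstenbergBoundary G X) :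
    ∃ F : C(X, stateSpace G), ∀ (s : G) x, (F (s • x) : Functional G) = s • (F x).1 := by
  obtain ⟨M, _, _, hM, F, hF⟩ := exists_isFurstenbergBoundary_map_stateSpace G
  obtain ⟨f, hf, hfG, -⟩ := hX.universal M hM.isBoundary
  exact ⟨F.comp ⟨f, hf⟩, fun s x =>
    (congrArg (fun q => (F q : Functional G)) (hfG s x)).trans (hF s (f x))⟩

end Universality

section Amenability

theorem exists_mem_stateSpace_of_positive {X : Type*} [TopologicalSpace X]
    (L : (X →ᵇ ℝ) →ₗ[ℝ] ℝ) (hL1 : L 1 = 1) (hL : ∀ f, 0 ≤ f → 0 ≤ L f) :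
    ∃ φ ∈ stateSpace X, ∀ f, φ f = L f := by
  have hbound (f : X →ᵇ ℝ) : ‖L f‖ ≤ 1 * ‖f‖ := by
    have hpos (g : X →ᵇ ℝ) (hg : ∀ x, -‖f‖ ≤ g x) : -‖f‖ ≤ L g := by
      have h := hL (g + ‖f‖ • 1) fun x => by simpa using neg_le_iff_add_nonneg.1 (hg x)
      rw [map_add, map_smul, hL1, smul_eq_mul, mul_one] at h
      exact neg_le_iff_add_nonneg.2 h
    have hneg := hpos (-f) fun x => neg_le_neg ((le_abs_self _).trans (f.norm_coe_le_norm x))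
    rw [map_neg] at hneg
    rw [one_mul]
    exact abs_le.2 ⟨hpos f fun x => (abs_le.1 (f.norm_coe_le_norm x)).1, neg_le_neg_iff.1 hneg⟩
  exact ⟨StrongDual.toWeakDual (L.mkContinuous 1 hbound), ⟨hL1, hL⟩, fun _ => rfl⟩

variable {G : Type*} [Group G] [TopologicalSpace G] [DiscreteTopology G]

theorem exists_mem_stateSpace_smul_eq_of_isAmenable (hG : IsAmenable G) :
    ∃ φ ∈ stateSpace G, ∀ s : G, s • φ = φ := by
  obtain ⟨m, hm1, hm, hmG⟩ := hG
  let ι : (G →ᵇ ℝ) →ₗ[ℝ] lp (fun _ : G => ℂ) ∞ := (lpBCFₗᵢ ℂ ℝ).symm.toLinearEquiv.toLinearMap ∘ₗ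
    (Complex.ofRealCLM.compLeftContinuousBounded G).toLinearMap
  obtain ⟨φ, hφ, hφm⟩ := exists_mem_stateSpace_of_positive
    (Complex.reLm ∘ₗ m.restrictScalars ℝ ∘ₗ ι)
    (show (m 1).re = 1 by rw [hm1, Complex.one_re])
    fun f hf => (Complex.nonneg_iff.1 (hm (ι f) fun t => Complex.zero_le_real.2 (hf t))).1
  refine ⟨φ, hφ, fun s => DFunLike.ext _ _ fun f => ?_⟩
  have hι : ι (f.compContinuous ⟨(s • ·), continuous_const_smul s⟩) = leftTranslate s⁻¹ (ι f) := by
    ext t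
    change (f (s * t) : ℂ) = f (s⁻¹⁻¹ * t)
    rw [inv_inv]
  rw [smul_apply, hφm, hφm]
  change (m _).re = (m _).re
  rw [hι, hmG]

theorem isAmenable_of_forall_smul_eq {φ : Functional G} (hφ : φ ∈ stateSpace G)
    (hfix : ∀ s : G, s • φ = φ) : IsAmenable G := by
  let re : lp (fun _ : G => ℂ) ∞ →ₗ[ℝ] (G →ᵇ ℝ) :=
    (Complex.reCLM.compLeftContinuousBounded G).toLinearMap ∘ₗ
      (lpBCFₗᵢ ℂ ℝ).toLinearEquiv.toLinearMap
  let m : lp (fun _ : G => ℂ) ∞ →ₗ[ℂ] ℂ :=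
    Module.Dual.extendRCLike ((φ : (G →ᵇ ℝ) →L[ℝ] ℝ).toLinearMap ∘ₗ re)
  have hm (f : lp (fun _ : G => ℂ) ∞) : m f = φ (re f) - Complex.I * φ (re (Complex.I • f)) := rfl
  have hreal (f : lp (fun _ : G => ℂ) ∞) (hf : ∀ t, (f t).im = 0) : m f = φ (re f) := by
    have hI : re (Complex.I • f) = 0 := by
      ext t
      change (Complex.I * f t).re = 0
      simp [hf t]
    rw [hm, hI, map_zero, Complex.ofReal_zero, mul_zero, sub_zero]
  refine ⟨m, ?_, fun f hf => ?_, fun s f => ?_⟩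
  · rw [hreal 1 fun _ => Complex.one_im]
    exact congrArg Complex.ofReal hφ.1
  · rw [hreal f fun t => (Complex.nonneg_iff.1 (hf t)).2.symm]
    exact Complex.zero_le_real.2 (hφ.2 _ fun t => (Complex.nonneg_iff.1 (hf t)).1)
  · have hinv (f : lp (fun _ : G => ℂ) ∞) : φ (re (leftTranslate s f)) = φ (re f) :=
      DFunLike.congr_fun (hfix s⁻¹) (re f)
    rw [hm, hm, hinv]
    exact congrArg (fun r : ℝ => (φ (re f) : ℂ) - Complex.I * r) (hinv (Complex.I • f))

end Amenability

theorem IsFurstenbergBoundary.subsingleton_iff_isAmenable {G X : Type u} [Group G]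
    [TopologicalSpace X] [MulAction G X] (hX : IsFurstenbergBoundary G X) :
    Subsingleton X ↔ IsAmenable G := by
  let _ : TopologicalSpace G := ⊥
  have : DiscreteTopology G := ⟨rfl⟩
  obtain ⟨⟨x⟩, _, _, _, -, -⟩ := id hX.isBoundary
  constructor
  · intro _
    obtain ⟨F, hF⟩ := hX.exists_map_stateSpace
    exact isAmenable_of_forall_smul_eq (F x).2 fun s => by rw [← hF, Subsingleton.elim (s • x) x]
  · intro hG
    obtain ⟨φ, hφ, hfix⟩ := exists_mem_stateSpace_smul_eq_of_isAmenable hG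
    exact hX.isBoundary.contracts.subsingleton_of_forall_smul_eq
      (barycenter_mem_stateSpace (orbitStates x) hφ) fun s => by
        rw [← barycenter_orbitStates_smul, hfix]

section ExtremalDisconnectedness

theorem extremallyDisconnected_of_monotone_leftInverse {X Y : Type*} [TopologicalSpace X]
    [TopologicalSpace Y] [NormalSpace X] [T1Space X] [ExtremallyDisconnected Y] (π : C(Y, X))
    {P : (Y →ᵇ ℝ) → (X →ᵇ ℝ)} (hP : Monotone P) (hPπ : ∀ h, P (h.compContinuous π) = h) :
    ExtremallyDisconnected X := by
  refine ⟨fun U hU => ?_⟩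
  have hW : IsClopen (closure (π ⁻¹' U)) :=
    ⟨isClosed_closure, ExtremallyDisconnected.open_closure _ (hU.preimage π.continuous)⟩
  let f : Y →ᵇ ℝ := .indicator (closure (π ⁻¹' U)) hW
  have hone {x : X} (hx : x ∈ U) : 1 ≤ P f x := by
    obtain ⟨h, hhU, hhx, hh⟩ := exists_bounded_zero_one_of_closed hU.isClosed_compl
      (isClosed_singleton (x := x)) (by simpa using hx)
    have hle : h.compContinuous π ≤ f := fun y => by
      by_cases hy : π y ∈ U
      · have hf : f y = 1 := Set.indicator_of_mem (subset_closure (s := π ⁻¹' U) hy) 1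
        exact (hh (π y)).2.trans hf.ge
      · exact (hhU hy).trans_le (Set.indicator_nonneg (fun _ _ => zero_le_one) y)
    calc 1 = h x := (hhx rfl).symm
      _ = P (h.compContinuous π) x := by rw [hPπ]
      _ ≤ P f x := hP hle x
  have hzero {x : X} (hx : x ∉ closure U) : P f x ≤ 0 := by
    obtain ⟨h, hhx, hhU, hh⟩ := exists_bounded_zero_one_of_closed (isClosed_singleton (x := x))
      (isClosed_closure (s := U)) (by simpa using hx)
    have hle : f ≤ h.compContinuous π := fun y =>
      Set.indicator_apply_le' (fun hy => (hhU (π.continuous.closure_preimage_subset U hy)).ge)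
        fun _ => (hh _).1
    calc P f x ≤ P (h.compContinuous π) x := hP hle x
      _ = h x := by rw [hPπ]
      _ = 0 := hhx rfl
  have hclosure : closure U = {x | 0 < P f x} := by
    ext x
    refine ⟨fun hx => ?_, fun hx => by_contra fun hxU => (hzero hxU).not_gt hx⟩
    have hx1 : 1 ≤ P f x :=
      closure_minimal (fun _ => hone) (isClosed_le continuous_const (P f).continuous) hx
    exact zero_lt_one.trans_le hx1
  rw [hclosure]
  exact isOpen_lt continuous_const (P f).continuous

theorem discreteTopology_of_metrizable_of_extremallyDisconnected (X : Type*) [TopologicalSpace X]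
    [TopologicalSpace.MetrizableSpace X] [ExtremallyDisconnected X] : DiscreteTopology X := by
  let _ := TopologicalSpace.metrizableSpaceMetric X
  refine discreteTopology_iff_isOpen_singleton.2 fun x => by_contra fun hx => ?_
  have hnear : ∀ ε > 0, ∃ y, dist y x < ε ∧ y ≠ x := by
    simpa only [Metric.isOpen_singleton_iff, not_exists, not_and, not_forall, exists_prop] using hx
  have hglb : IsGLB ((dist · x) '' {x}ᶜ) 0 := by
    refine ⟨by rintro _ ⟨y, -, rfl⟩; exact dist_nonneg, fun c hc => not_lt.1 fun hc0 => ?_⟩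
    obtain ⟨y, hy, hyx⟩ := hnear c hc0
    exact (hc ⟨y, hyx, rfl⟩).not_gt hy
  have hzero : (0 : ℝ) ∉ (dist · x) '' {x}ᶜ := fun ⟨y, hyx, hy⟩ => hyx (dist_eq_zero.1 hy)
  have hne : ((dist · x) '' {x}ᶜ).Nonempty :=
    let ⟨y, _, hyx⟩ := hnear 1 one_pos
    ⟨_, y, hyx, rfl⟩
  obtain ⟨u, hu, -, hu0, hux⟩ := hglb.exists_seq_strictAnti_tendsto_of_notMem hzero hne
  -- The even and the odd annuli form disjoint open sets that both accumulate at `x`.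
  let annulus (n : ℕ) : Set X := (dist · x) ⁻¹' Set.Ioo (u (2 * (n + 1))) (u (2 * n))
  have hopen (n : ℕ) : IsOpen (annulus n) :=
    isOpen_Ioo.preimage (continuous_id.dist continuous_const)
  have hdisj : Pairwise (Function.onFun Disjoint annulus) := fun m n hmn =>
    ((hu.antitone.comp_monotone (monotone_id.const_mul' 2)).pairwise_disjoint_on_Ioo_succ
      hmn).preimage _
  have hmem (i : ℕ) : x ∈ closure (⋃ n, annulus (2 * n + i)) := by
    refine Metric.mem_closure_iff.2 fun ε hε => ?_
    obtain ⟨n, hn⟩ := (hu0.eventually_lt_const hε).exists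
    obtain ⟨y, -, hy : dist y x = u (2 * (2 * n + i) + 1)⟩ := hux (2 * (2 * n + i) + 1)
    refine ⟨y, Set.mem_iUnion.2 ⟨n, ?_⟩, ?_⟩
    · change dist y x ∈ Set.Ioo _ _
      rw [hy]
      exact ⟨hu (by lia), hu (by lia)⟩
    · rw [dist_comm, hy]
      exact (hu.antitone (by lia)).trans_lt hn
  refine Set.disjoint_left.1 (ExtremallyDisconnected.disjoint_closure_of_disjoint_isOpen ?_
    (isOpen_iUnion fun n => hopen _) (isOpen_iUnion fun n => hopen _)) (hmem 0) (hmem 1)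
  exact Set.disjoint_iUnion_left.2 fun m => Set.disjoint_iUnion_right.2 fun n => hdisj (by lia)

variable {G X : Type u} [Group G] [TopologicalSpace X] [MulAction G X]

theorem IsFurstenbergBoundary.extremallyDisconnected (hX : IsFurstenbergBoundary G X) :
    ExtremallyDisconnected X := by
  let _ : TopologicalSpace G := ⊥
  have : DiscreteTopology G := ⟨rfl⟩
  have : ExtremallyDisconnected G := ⟨fun _ _ => isOpen_discrete _⟩
  obtain ⟨F, hF⟩ := hX.exists_map_stateSpace
  obtain ⟨⟨b⟩, _, _, _, -, -⟩ := id hX.isBoundary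
  refine extremallyDisconnected_of_monotone_leftInverse
    (Y := G) ⟨(· • b), continuous_of_discreteTopology⟩ (P := markovOperator F)
    (fun f g hfg x => apply_le_apply_of_mem_stateSpace (F x).2 hfg) fun h => ?_
  ext x
  exact DFunLike.congr_fun
    (hX.isBoundary.contracts.eq_dirac_of_equivariant (pushStates_smul hF b) x) h

theorem IsFurstenbergBoundary.subsingleton_of_metrizableSpace (hX : IsFurstenbergBoundary G X)
    [TopologicalSpace.MetrizableSpace X] : Subsingleton X := by
  have := hX.extremallyDisconnected
  have := discreteTopology_of_metrizable_of_extremallyDisconnected X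
  obtain ⟨⟨x⟩, _, _, _, -, -⟩ := id hX.isBoundary
  exact hX.isBoundary.contracts.subsingleton_of_isOpen_singleton (isOpen_discrete {x})

end ExtremalDisconnectedness

theorem metrizableSpace_of_separableSpace_continuousMap {X : Type*} [TopologicalSpace X]
    [CompactSpace X] [T2Space X] [TopologicalSpace.SeparableSpace C(X, ℂ)] :
    TopologicalSpace.MetrizableSpace X := by
  let F : X → ℕ → ℂ := fun x n => TopologicalSpace.denseSeq C(X, ℂ) n x
  have hF : Continuous F := continuous_pi fun n => (TopologicalSpace.denseSeq C(X, ℂ) n).continuous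
  have hFinj : Function.Injective F := fun x y hxy => by
    have heval : (fun f : C(X, ℂ) => f x) = fun f => f y :=
      (TopologicalSpace.denseRange_denseSeq _).equalizer (continuous_eval_const x)
        (continuous_eval_const y) (funext (congrFun hxy))
    refine dirac_injective (DFunLike.ext _ _ fun f => ?_)
    exact Complex.ofReal_injective (congrFun heval ⟨fun z => (f z : ℂ), by fun_prop⟩)
  exact (hF.isClosedEmbedding hFinj).isEmbedding.metrizableSpace

end Furstenberg

theorem mainTheorem10 (G : Type u) [Group G] :
    (∃ (X : Type u) (_ : TopologicalSpace X) (_ : MulAction G X),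
      Furstenberg.IsFurstenbergBoundary G X) ∧
    ∀ (X : Type u) [TopologicalSpace X] [MulAction G X], Furstenberg.IsFurstenbergBoundary G X →
      ((∃ x : X, ∀ y : X, y = x) ∨ ¬ TopologicalSpace.MetrizableSpace X) ∧
      ((∃ x : X, ∀ y : X, y = x) ↔ Furstenberg.IsAmenable G) ∧
      (Furstenberg.IsAmenable G → Function.Bijective (algebraMap ℂ C(X, ℂ))) ∧
      (¬ Furstenberg.IsAmenable G →
        ¬ TopologicalSpace.MetrizableSpace X ∧
        (∀ x : X, ¬ IsOpen ({x} : Set X)) ∧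
        ¬ TopologicalSpace.SeparableSpace C(X, ℂ)) := by
  let _ : TopologicalSpace G := ⊥
  have : DiscreteTopology G := ⟨rfl⟩
  obtain ⟨X₀, _, _, hX₀, -⟩ := Furstenberg.exists_isFurstenbergBoundary_map_stateSpace G
  refine ⟨⟨X₀, _, _, hX₀⟩, fun X _ _ hX => ?_⟩
  obtain ⟨_, _, _, _, -, -⟩ := id hX.isBoundary
  have hpoint : (∃ x : X, ∀ y : X, y = x) ↔ Subsingleton X :=
    ⟨fun ⟨x, hx⟩ => ⟨fun y z => (hx y).trans (hx z).symm⟩, fun _ =>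
      ⟨Classical.arbitrary X, fun y => Subsingleton.elim y _⟩⟩
  have hamenable : Subsingleton X ↔ Furstenberg.IsAmenable G := hX.subsingleton_iff_isAmenable
  have hmetrizable : TopologicalSpace.MetrizableSpace X → Subsingleton X := fun _ =>
    hX.subsingleton_of_metrizableSpace
  rw [hpoint, ← hamenable]
  refine ⟨or_iff_not_imp_left.2 (mt hmetrizable), Iff.rfl, fun _ => ?_, fun hG =>
    ⟨mt hmetrizable hG, fun x hx => hG ?_, fun _ => hG (hmetrizable ?_)⟩⟩
  · refine ⟨(algebraMap ℂ C(X, ℂ)).injective, fun f => ⟨f (Classical.arbitrary X), ?_⟩⟩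
    ext x
    exact congrArg f (Subsingleton.elim _ x)
  · exact hX.isBoundary.contracts.subsingleton_of_isOpen_singleton hx
  · exact Furstenberg.metrizableSpace_of_separableSpace_continuousMap
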